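/- Let $G=(V,E)$ be a finite simple graph with $V\neq\emptyset$, and let $k>0$ be an integer. An *oriented separation* of $G$ is a pair $(A,B)$ of subsets of $V$ with $A\cup B=V$ such that $G$ has no edge between $A\smallsetminus B$ and $B\smallsetminus A$. Its inverse is $(A,B)^*=(B,A)$, its order is $|A\cap B|$, and $(A,B)\le(C,D)$ means $A\subseteq C$ and $B\supseteq D$. Let $\vec S_k$ be the set of oriented separations of order less than $k$, and $S_k$ the set of unoriented separations $\{s,s^*\}$ with $s\in\vec S_k$ (we also write $\{A,B\}$ for $\{(A,B),(B,A)\}$). A *star* is a non-empty set $\sigma$ of oriented separations such that $r\le s^*$ for all distinct $r,s\in\sigma$. Let $\mathcal F_k^{(2)}$ be the set of all stars $\sigma=\{(A_1,B_1),(A_2,B_2)\}\subseteq\vec S_k$ (the two separations need not be distinct) with $|B_1\cap B_2|<k$. * An *$\mathcal F_k^{(2)}$-tangle of $S_k$* is a set $O\subseteq\vec S_k$ that contains exactly one element of each $\{s,s^*\}\in S_k$, is consistent (there are no $r,s\in\vec S_k$ with $\{r,r^*\}\ne\{s,s^*\}$, $r<s$ and $r^*,s\in O$), and has no subset in $\mathcal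 F_k^{(2)}$. * An *$S_k$-tree over $\mathcal F_k^{(2)}$* is a pair $(T,\alpha)$ of a finite tree $T$ with at least one edge and a map $\alpha$ from the set of orientations $(x,y)$ of edges $xy$ of $T$ to $\vec S_k$ such that $\alpha(y,x)=\alpha(x,y)^*$ for every edge $xy$, and $\{\alpha(x,t): xt\in E(T)\}\in\mathcal F_k^{(2)}$ for every node $t$ of $T$. * For $X\subseteq V$ let $\partial(X)$ be the set of vertices in $X$ that have a neighbour outside $X$. A *blockage of order $k-1$* is a collection $\mathcal B$ of subsets of $V$ such that: $|\partial(X)|<k$ for all $X\in\mathcal B$; $X'\in\mathcal B$ whenever $X'\subseteq X\in\mathcal B$ and $|\partial(X')|<k$; and for every $\{X_1,X_2\}\in S_k$ exactly one element of $\{X_1,X_2\}$ lies in $\mathcal B$. * The *path-width* of $G$ is the least width $\max_t|V_t|-1$ of a tree-decomposition $(T,(V_t)_{t\in T})$ of $G$ whose decomposition tree $T$ is a (finite) path. Theorem. The following assertions are equivalent: (i) $G$ has a blockage of order $k-1$. (ii) $G$ has an $\mathcal F_k^{(2)}$-tangle of $S_k$. (iii) $G$ has no $S_k$-tree over $\mathcal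 F_k^{(2)}$. (iv) $G$ has path-width at least $k-1$. -/

import Mathlib

namespace SepDuality

/-- A separation system: a partially ordered set with an order-reversing involution `inv`.
Its elements are the *oriented separations*. -/
class SeparationSystem (U : Type*) extends PartialOrder U where
  inv : U → U
  inv_inv : ∀ s : U, inv (inv s) = s
  inv_le_inv : ∀ r s : U, r ≤ s ↔ inv s ≤ inv r

open SeparationSystem (inv)

section Abstract

/-- The (unoriented) separation `{s, s*}` underlying an oriented separation `s`. -/
def unoriented {U : Type*} [SeparationSystem U] (s : U) : Set U := {s, inv s}

/-- In the next definitions a separation system inside `U` is given by its set `S : Set U` of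
oriented separations.  `O` is an *orientation* if it contains, for every separation
`{s, s*}` with `s ∈ S`, exactly one of the elements of `{s, s*}`. -/
def IsOrientation {U : Type*} [SeparationSystem U] (S O : Set U) : Prop :=
  O ⊆ S ∧ ∀ s ∈ S, ∃! x, x ∈ unoriented s ∧ x ∈ O

/-- `O` is *consistent*: there are no distinct separations with orientations `r < s`
such that `r*, s ∈ O`. -/
def IsConsistent {U : Type*} [SeparationSystem U] (S O : Set U) : Prop :=
  ∀ r ∈ S, ∀ s ∈ S, unoriented r ≠ unoriented s → r < s → ¬ (inv r ∈ O ∧ s ∈ O)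

/-- A *star*: a nonempty set of oriented separations that point towards each other. -/
def IsStar {U : Type*} [SeparationSystem U] (σ : Set U) : Prop :=
  σ.Nonempty ∧ ∀ r ∈ σ, ∀ s ∈ σ, r ≠ s → r ≤ inv s

/-- `O` is an `F`-*tangle* of `S`: a consistent orientation of `S` no subset of which lies
in `F`. -/
def IsTangle {U : Type*} [SeparationSystem U] (S : Set U) (F : Set (Set U)) (O : Set U) : Prop :=
  IsOrientation S O ∧ IsConsistent S O ∧ ∀ σ ⊆ O, σ ∉ F

/-- `(T, α)` is an `S`-*tree over* `F`.  The oriented edges `(x, y)` of `T` are its darts. -/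
structure IsSTreeOver {U : Type*} [SeparationSystem U] (S : Set U) (F : Set (Set U))
    {N : Type*} (T : SimpleGraph N) (α : T.Dart → U) : Prop where
  finite_nodes : Finite N
  isTree : T.IsTree
  has_edge : T.edgeSet.Nonempty
  mem : ∀ e, α e ∈ S
  map_symm : ∀ e, α e.symm = inv (α e)
  star_mem : ∀ t : N, α '' {e | e.snd = t} ∈ F

/-- There is an `S`-tree over `F`. -/
def HasSTreeOver {U : Type*} [SeparationSystem U] (S : Set U) (F : Set (Set U)) : Prop :=
  ∃ (N : Type) (T : SimpleGraph N) (α : T.Dart → U), IsSTreeOver S F T α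

end Abstract

section Graph

/-- The oriented vertex separations `(left, right)` of a graph `G`. -/
@[ext]
structure GraphSep {V : Type*} (G : SimpleGraph V) where
  left : Set V
  right : Set V
  cover : left ∪ right = Set.univ
  no_edge : ∀ a ∈ left \ right, ∀ b ∈ right \ left, ¬ G.Adj a b

/-- `(A, B) ≤ (C, D)` iff `A ⊆ C` and `B ⊇ D`, and `(A, B)* = (B, A)`. -/
instance GraphSep.separationSystem {V : Type*} (G : SimpleGraph V) :
    SeparationSystem (GraphSep G) where
  le r s := r.left ⊆ s.left ∧ s.right ⊆ r.right
  le_refl _ := ⟨subset_rfl, subset_rfl⟩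
  le_trans _ _ _ h₁ h₂ := ⟨h₁.1.trans h₂.1, h₂.2.trans h₁.2⟩
  le_antisymm _ _ h₁ h₂ :=
    GraphSep.ext (Set.Subset.antisymm h₁.1 h₂.1) (Set.Subset.antisymm h₂.2 h₁.2)
  inv s :=
    { left := s.right
      right := s.left
      cover := by rw [Set.union_comm]; exact s.cover
      no_edge := fun a ha b hb h => s.no_edge b hb a ha h.symm }
  inv_inv _ := rfl
  inv_le_inv _ _ := ⟨fun h => ⟨h.2, h.1⟩, fun h => ⟨h.2, h.1⟩⟩

/-- The order `|A ∩ B|` of a separation `(A, B)`. -/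
noncomputable def GraphSep.order {V : Type*} {G : SimpleGraph V} (s : GraphSep G) : ℕ :=
  (s.left ∩ s.right).ncard

/-- The oriented separations of `G` of order less than `k`. -/
def sepsBelow {V : Type*} (G : SimpleGraph V) (k : ℕ) : Set (GraphSep G) :=
  {s | s.order < k}

/-- The stars `{(A₁, B₁), (A₂, B₂)}` of separations of order `< k` with `|B₁ ∩ B₂| < k`;
the two separations need not be distinct. -/
def starsTwo {V : Type*} (G : SimpleGraph V) (k : ℕ) : Set (Set (GraphSep G)) :=
  {σ | σ ⊆ sepsBelow G k ∧ IsStar σ ∧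
    ∃ s₁ s₂ : GraphSep G, σ = {s₁, s₂} ∧ (s₁.right ∩ s₂.right).ncard < k}

/-- `∂(X)`: the vertices in `X` that have a neighbour outside `X`. -/
def boundary {V : Type*} (G : SimpleGraph V) (X : Set V) : Set V :=
  {v | v ∈ X ∧ ∃ w, w ∉ X ∧ G.Adj v w}

/-- A *blockage of order* `n` (so with `n = k - 1` the bounds are `< k`). -/
structure IsBlockage {V : Type*} (G : SimpleGraph V) (n : ℕ) (B : Set (Set V)) : Prop where
  boundary_lt : ∀ X ∈ B, (boundary G X).ncard < n + 1
  subset_mem : ∀ X ∈ B, ∀ X' ⊆ X, (boundary G X').ncard < n + 1 → X' ∈ B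
  exactly_one : ∀ s ∈ sepsBelow G (n + 1),
    ∃! X, X ∈ ({s.left, s.right} : Set (Set V)) ∧ X ∈ B

/-- `(T, bag)` is a *tree-decomposition* of `G`. -/
structure IsTreeDecomposition {V : Type*} (G : SimpleGraph V) {N : Type*} (T : SimpleGraph N)
    (bag : N → Set V) : Prop where
  isTree : T.IsTree
  vertex_mem : ∀ v, ∃ t, v ∈ bag t
  edge_mem : ∀ u v, G.Adj u v → ∃ t, u ∈ bag t ∧ v ∈ bag t
  inter_subset : ∀ (t₁ t₃ : N) (p : T.Walk t₁ t₃), p.IsPath →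
    ∀ t₂ ∈ p.support, bag t₁ ∩ bag t₃ ⊆ bag t₂

/-- The width `max |bag t| - 1` of a decomposition with finitely many bags, of a finite
nonempty graph. -/
noncomputable def decompositionWidth {V N : Type*} (bag : N → Set V) : ℕ :=
  (⨆ t, (bag t).ncard) - 1

/-- The *path-width* of a finite nonempty graph: the least width of a tree-decomposition
whose tree is a path. -/
noncomputable def pathWidth {V : Type*} (G : SimpleGraph V) : ℕ :=
  sInf {w | ∃ (n : ℕ) (bag : Fin n → Set V),
    IsTreeDecomposition G (SimpleGraph.pathGraph n) bag ∧ decompositionWidth bag = w}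

end Graph

end SepDuality

/-! Only (iv) → (i) is deep. Read `IsStep k s t` as "orienting by `s` forces `t`": going down
preserves smallness of the left side, and so does adding a bag of size `< k`. A path-decomposition
of width `< k - 1` is a path of up-steps from `(∅, V)` to `(V, ∅)`.

The crux is `exists_isUpStep_path_of_isStep_path`: submodularity lets any chain of forcings be made
monotone, apart from one descent at either end. Between `(∅, V)` and `(V, ∅)` these descents vanish.
Hence, if the path-width is at least `k - 1`, what `(∅, V)` forces is free of contradictions. A
maximal contradiction-free closed set is total: by `IsPartialTangle.not_path_inv`, an unoriented
separation of least order can still be added. Its left sides form a blockage.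

The other implications are direct: a blockage orients each separation, a tangle sends every node of
an `S_k`-tree along an outgoing edge although a tree has fewer edges than nodes, and a narrow
path-decomposition is itself an `S_k`-tree. -/

namespace SepDuality

open SeparationSystem (inv)
open Relation

/-! ### The lattice of graph separations and submodularity of the order. -/

section Lattice

variable {V : Type*} {G : SimpleGraph V}

namespace GraphSep

@[simp] lemma inv_left (s : GraphSep G) : (inv s).left = s.right := rfl

@[simp] lemma inv_right (s : GraphSep G) : (inv s).right = s.left := rfl

lemma inv_le_inv {r s : GraphSep G} (h : r ≤ s) : inv s ≤ inv r := ⟨h.2, h.1⟩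

lemma mem_left_or_mem_right (s : GraphSep G) (v : V) : v ∈ s.left ∨ v ∈ s.right := by
  have : v ∈ s.left ∪ s.right := s.cover ▸ Set.mem_univ v
  exact this

lemma not_adj (s : GraphSep G) {a b : V} (ha : a ∉ s.right) (hb : b ∉ s.left) :
    ¬ G.Adj a b :=
  s.no_edge a ⟨(s.mem_left_or_mem_right a).resolve_right ha, ha⟩
    b ⟨(s.mem_left_or_mem_right b).resolve_left hb, hb⟩

/-- A pair of sets covering `V` with no edge across is a separation. -/
def mk' (A B : Set V) (h : ∀ v, v ∈ A ∨ v ∈ B)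
    (h' : ∀ a b, a ∉ B → b ∉ A → ¬ G.Adj a b) : GraphSep G where
  left := A
  right := B
  cover := Set.eq_univ_of_forall h
  no_edge a ha b hb := h' a b ha.2 hb.2

/-- The separation `(∅, V)`. -/
def bot (G : SimpleGraph V) : GraphSep G :=
  mk' ∅ Set.univ (by simp) (by simp)

/-- The separation `(V, ∅)`. -/
def top (G : SimpleGraph V) : GraphSep G := inv (bot G)

/-- The infimum `(A ∩ C, B ∪ D)` of `(A, B)` and `(C, D)`. -/
def inf (s t : GraphSep G) : GraphSep G :=
  mk' (s.left ∩ t.left) (s.right ∪ t.right)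
    (fun v => by
      have := s.mem_left_or_mem_right v
      have := t.mem_left_or_mem_right v
      simp only [Set.mem_inter_iff, Set.mem_union]; tauto)
    (fun a b ha hb => by
      simp only [Set.mem_inter_iff, Set.mem_union, not_or, not_and_or] at ha hb
      rcases hb with hb | hb
      · exact s.not_adj ha.1 hb
      · exact t.not_adj ha.2 hb)

/-- The supremum `(A ∪ C, B ∩ D)` of `(A, B)` and `(C, D)`. -/
def sup (s t : GraphSep G) : GraphSep G := inv (inf (inv s) (inv t))

/-- For `(A, B) ≤ (C, D)` the separation `(C, B)`. -/
def bag {s t : GraphSep G} (h : s ≤ t) : GraphSep G :=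
  mk' t.left s.right
    (fun v => (s.mem_left_or_mem_right v).imp_left fun hv => h.1 hv)
    (fun _ _ ha hb => s.not_adj ha fun hb' => hb (h.1 hb'))

/-- The separation with left side `X` and least right side. -/
def ofSet (G : SimpleGraph V) (X : Set V) : GraphSep G :=
  mk' X (Xᶜ ∪ boundary G X)
    (fun v => by by_cases hv : v ∈ X <;> simp [hv])
    (fun a b ha hb hab => ha (by
      by_cases hv : a ∈ X
      · exact .inr ⟨hv, b, hb, hab⟩
      · exact .inl hv))

@[simp] lemma ofSet_left (X : Set V) : (ofSet G X).left = X := rfl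
@[simp] lemma ofSet_right (X : Set V) : (ofSet G X).right = Xᶜ ∪ boundary G X := rfl
@[simp] lemma bot_left : (bot G).left = ∅ := rfl
@[simp] lemma bot_right : (bot G).right = Set.univ := rfl
@[simp] lemma top_left : (top G).left = Set.univ := rfl
@[simp] lemma top_right : (top G).right = ∅ := rfl
@[simp] lemma inf_left (s t : GraphSep G) : (inf s t).left = s.left ∩ t.left := rfl
@[simp] lemma inf_right (s t : GraphSep G) : (inf s t).right = s.right ∪ t.right := rfl
@[simp] lemma sup_left (s t : GraphSep G) : (sup s t).left = s.left ∪ t.left := rfl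
@[simp] lemma sup_right (s t : GraphSep G) : (sup s t).right = s.right ∩ t.right := rfl
@[simp] lemma bag_left {s t : GraphSep G} (h : s ≤ t) : (bag h).left = t.left := rfl
@[simp] lemma bag_right {s t : GraphSep G} (h : s ≤ t) : (bag h).right = s.right := rfl

lemma bot_le (s : GraphSep G) : bot G ≤ s := ⟨Set.empty_subset _, Set.subset_univ _⟩

lemma le_top (s : GraphSep G) : s ≤ top G := ⟨Set.subset_univ _, Set.empty_subset _⟩

lemma inf_le_left (s t : GraphSep G) : inf s t ≤ s :=
  ⟨Set.inter_subset_left, Set.subset_union_left⟩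

lemma inf_le_right (s t : GraphSep G) : inf s t ≤ t :=
  ⟨Set.inter_subset_right, Set.subset_union_right⟩

lemma le_inf {r s t : GraphSep G} (hs : r ≤ s) (ht : r ≤ t) : r ≤ inf s t :=
  ⟨Set.subset_inter hs.1 ht.1, Set.union_subset hs.2 ht.2⟩

lemma inf_le_inf {r s : GraphSep G} (h : r ≤ s) (t : GraphSep G) : inf r t ≤ inf s t :=
  le_inf ((inf_le_left r t).trans h) (inf_le_right r t)

lemma inf_eq_right {s t : GraphSep G} (h : t ≤ s) : inf s t = t :=
  le_antisymm (inf_le_right s t) (le_inf h le_rfl)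

lemma le_sup_left (s t : GraphSep G) : s ≤ sup s t := inv_le_inv (inf_le_left (inv s) (inv t))

lemma le_sup_right (s t : GraphSep G) : t ≤ sup s t := inv_le_inv (inf_le_right (inv s) (inv t))

lemma sup_le {r s t : GraphSep G} (hr : r ≤ t) (hs : s ≤ t) : sup r s ≤ t :=
  inv_le_inv (le_inf (inv_le_inv hr) (inv_le_inv hs))

lemma order_inv (s : GraphSep G) : (inv s).order = s.order := by
  simp [order, Set.inter_comm]

@[simp] lemma order_bot : (bot G).order = 0 := by simp [order]

lemma le_ofSet (s : GraphSep G) : s ≤ ofSet G s.left := by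
  refine ⟨subset_rfl, ?_⟩
  rintro v (hv | ⟨-, w, hw, hvw⟩)
  · exact (s.mem_left_or_mem_right v).resolve_left hv
  · by_contra hv
    exact s.not_adj hv hw hvw

lemma ofSet_mono {X Y : Set V} (h : X ⊆ Y) : ofSet G X ≤ ofSet G Y := by
  refine ⟨h, ?_⟩
  rintro v (hv | ⟨-, w, hw, hvw⟩)
  · exact .inl fun hv' => hv (h hv')
  · by_cases hv : v ∈ X
    · exact .inr ⟨hv, w, fun hw' => hw (h hw'), hvw⟩
    · exact .inl hv

lemma order_ofSet (X : Set V) : (ofSet G X).order = (boundary G X).ncard := by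
  unfold order
  congr 1
  ext v
  simp only [ofSet_left, ofSet_right, Set.mem_inter_iff, Set.mem_union, Set.mem_compl_iff]
  exact ⟨fun h => h.2.resolve_left (not_not.2 h.1), fun h => ⟨h.1, .inr h⟩⟩

instance [Finite V] : Finite (GraphSep G) :=
  Finite.of_injective (fun s : GraphSep G => (s.left, s.right)) fun s t h => by
    simp only [Prod.mk.injEq] at h
    exact GraphSep.ext h.1 h.2

/-- The order of separations is submodular. -/
lemma order_sup_add_order_inf [Finite V] (s t : GraphSep G) :
    (sup s t).order + (inf s t).order ≤ s.order + t.order := by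
  unfold order
  rw [← Set.ncard_union_add_ncard_inter ((sup s t).left ∩ (sup s t).right),
    ← Set.ncard_union_add_ncard_inter (s.left ∩ s.right)]
  refine add_le_add (Set.ncard_le_ncard fun v hv => ?_) (Set.ncard_le_ncard fun v hv => ?_)
  all_goals
    simp only [Set.mem_inter_iff, Set.mem_union, sup_left, sup_right, inf_left, inf_right] at hv ⊢
    tauto

end GraphSep

end Lattice

/-! ### Forcing between separations, and extension to a total partial tangle. -/

section Steps

variable {V : Type*} {G : SimpleGraph V}

open GraphSep

/-- `t` is reached from `s` by adding a bag of size `< k`. -/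
def IsUpStep (k : ℕ) (s t : GraphSep G) : Prop :=
  s ≤ t ∧ (s.right ∩ t.left).ncard < k

/-- A step between separations of order `< k` that goes down or adds a bag of size `< k`. -/
def IsStep (k : ℕ) (s t : GraphSep G) : Prop :=
  s.order < k ∧ t.order < k ∧ (t ≤ s ∨ IsUpStep k s t)

lemma IsUpStep.inv {k : ℕ} {s t : GraphSep G} (h : IsUpStep k s t) :
    IsUpStep k (inv t) (inv s) :=
  ⟨inv_le_inv h.1, by simpa [Set.inter_comm] using h.2⟩

lemma IsStep.inv {k : ℕ} {s t : GraphSep G} (h : IsStep k s t) :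
    IsStep k (inv t) (inv s) :=
  ⟨(order_inv t).trans_lt h.2.1, (order_inv s).trans_lt h.1,
    h.2.2.imp inv_le_inv IsUpStep.inv⟩

/-- Forcing admits contraposition, since inversion reverses each single step. -/
lemma reflTransGen_isStep_inv {k : ℕ} {s t : GraphSep G}
    (h : ReflTransGen (IsStep k) s t) : ReflTransGen (IsStep k) (inv t) (inv s) := by
  induction h with
  | refl => exact .refl
  | tail _ h ih => exact .head h.inv ih

lemma le_of_reflTransGen_isUpStep {k : ℕ} {s t : GraphSep G}
    (h : ReflTransGen (IsUpStep k) s t) : s ≤ t := by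
  induction h with
  | refl => exact le_rfl
  | tail _ h ih => exact ih.trans h.1

variable [Finite V]

lemma IsUpStep.order_left_lt {k : ℕ} {s t : GraphSep G} (h : IsUpStep k s t) : s.order < k :=
  (Set.ncard_le_ncard (t := s.right ∩ t.left) fun _ hv => ⟨hv.2, h.1.1 hv.1⟩).trans_lt h.2

lemma IsUpStep.order_right_lt {k : ℕ} {s t : GraphSep G} (h : IsUpStep k s t) : t.order < k :=
  (Set.ncard_le_ncard (t := s.right ∩ t.left) fun _ hv => ⟨h.1.2 hv.2, hv.1⟩).trans_lt h.2

lemma IsUpStep.isStep {k : ℕ} {s t : GraphSep G} (h : IsUpStep k s t) : IsStep k s t :=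
  ⟨h.order_left_lt, h.order_right_lt, .inr h⟩

lemma isStep_of_reflTransGen_isUpStep {k : ℕ} {s t : GraphSep G}
    (h : ReflTransGen (IsUpStep k) s t) : ReflTransGen (IsStep k) s t :=
  ReflTransGen.mono (fun _ _ => IsUpStep.isStep) _ _ h

/-- Intersecting an up-path with a separation of least order below its end. -/
lemma reflTransGen_isUpStep_inf {k : ℕ} {w z m : GraphSep G}
    (h : ReflTransGen (IsUpStep k) w z) (hmz : m ≤ z)
    (hm : ∀ y, m ≤ y → y ≤ z → m.order ≤ y.order) :
    ReflTransGen (IsUpStep k) (inf w m) m := by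
  induction h using ReflTransGen.head_induction_on with
  | refl => rw [inf_eq_right hmz]
  | @head s t hst htz ih =>
    refine .head ⟨inf_le_inf hst.1 m, ?_⟩ ih
    have htz' := le_of_reflTransGen_isUpStep htz
    -- The supremum of the bag separation with `m` lies between `m` and `z`, so its order is at
    -- least that of `m`. By submodularity the infimum, which carries the bag of the new step, is
    -- then no larger than the old bag.
    have hu : bag hst.1 ≤ z :=
      ⟨htz'.1, (hst.1.trans htz').2⟩
    have h₁ := hm (sup (bag hst.1) m) (le_sup_right _ _) (sup_le hu hmz)
    have h₂ := order_sup_add_order_inf (bag hst.1) m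
    have h₃ : (bag hst.1).order < k := by
      simpa [order, Set.inter_comm] using hst.2
    have h₄ : ((inf s m).right ∩ (inf t m).left) =
        (inf (bag hst.1) m).left ∩ (inf (bag hst.1) m).right := by
      simp [Set.inter_comm]
    rw [h₄]
    change (inf (bag hst.1) m).order < k
    omega

/-- A step path can be replaced by one that goes down once, then up, then down once. -/
lemma exists_isUpStep_path_of_isStep_path {k : ℕ} {x y : GraphSep G} (hx : x.order < k)
    (h : ReflTransGen (IsStep k) x y) :
    ∃ w z, w.order < k ∧ w ≤ x ∧ ReflTransGen (IsUpStep k) w z ∧ y ≤ z := by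
  induction h with
  | refl => exact ⟨x, x, hx, le_rfl, .refl, le_rfl⟩
  | @tail y y' hxy hyy' ih =>
    obtain ⟨w, z, hw, hwx, hwz, hyz⟩ := ih
    obtain ⟨hy, hy', h | h⟩ := hyy'
    · exact ⟨w, z, hw, hwx, hwz, h.trans hyz⟩
    -- Only an up-step out of `y` needs work. The up-path is cut off at a separation `m` of least
    -- order between `y` and `z`, and the step is redone from `m`; minimality of `m` and
    -- submodularity bound both the truncated bags and the new one.
    obtain ⟨m, ⟨hym, hmz⟩, hm⟩ :=
      Set.exists_min_image {m : GraphSep G | y ≤ m ∧ m ≤ z} GraphSep.order (Set.toFinite _)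
        ⟨y, le_rfl, hyz⟩
    have hm' : ∀ a, m ≤ a → a ≤ z → m.order ≤ a.order := fun a h₁ h₂ => hm a ⟨hym.trans h₁, h₂⟩
    have hup : IsUpStep k m (sup m y') := by
      refine ⟨le_sup_left _ _, ?_⟩
      have hum := hm (inf (bag h.1) m) ⟨le_inf ⟨h.1.1, subset_rfl⟩ hym,
        (inf_le_right _ _).trans hmz⟩
      have h₂ := order_sup_add_order_inf (bag h.1) m
      have h₃ : (bag h.1).order < k := by
        simpa [order, Set.inter_comm] using h.2
      have h₄ : m.right ∩ (sup m y').left =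
          (sup (bag h.1) m).left ∩ (sup (bag h.1) m).right := by
        ext v
        have := @hym.2 v
        simp only [Set.mem_inter_iff, Set.mem_union, sup_left, sup_right, bag_left, bag_right]
        tauto
      rw [h₄]
      change (sup (bag h.1) m).order < k
      omega
    refine ⟨inf w m, sup m y', ?_, (inf_le_left _ _).trans hwx,
      (reflTransGen_isUpStep_inf hwz hmz hm').tail hup, le_sup_right _ _⟩
    have h₁ := hm' (sup w m) (le_sup_right _ _) (sup_le (le_of_reflTransGen_isUpStep hwz) hmz)
    have h₂ := order_sup_add_order_inf w m
    omega

lemma isUpStep_path_bot_top {k : ℕ} (hk : 0 < k)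
    (h : ReflTransGen (IsStep k) (bot G) (top G)) :
    ReflTransGen (IsUpStep k) (bot G) (top G) := by
  obtain ⟨w, z, -, hw, hwz, hz⟩ := exists_isUpStep_path_of_isStep_path (by simpa using hk) h
  rwa [le_antisymm hw (bot_le w), le_antisymm (le_top z) hz] at hwz

/-- A set of separations of order `< k` that is closed under steps, contains `(∅, V)`,
and contains no separation together with its inverse. -/
structure IsPartialTangle (k : ℕ) (P : Set (GraphSep G)) : Prop where
  order_lt : ∀ s ∈ P, s.order < k
  bot_mem : bot G ∈ P
  closed : ∀ s ∈ P, ∀ t, IsStep k s t → t ∈ P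
  not_both : ∀ s ∈ P, inv s ∉ P

omit [Finite V] in
lemma IsPartialTangle.mem_of_path {k : ℕ} {P : Set (GraphSep G)} (hP : IsPartialTangle k P)
    {s t : GraphSep G} (hs : s ∈ P) (h : ReflTransGen (IsStep k) s t) : t ∈ P := by
  induction h with
  | refl => exact hs
  | tail _ h ih => exact hP.closed _ ih _ h

omit [Finite V] in
lemma IsPartialTangle.mem_of_le {k : ℕ} {P : Set (GraphSep G)} (hP : IsPartialTangle k P)
    {s t : GraphSep G} (hs : s ∈ P) (h : t ≤ s) (ht : t.order < k) : t ∈ P :=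
  hP.closed s hs t ⟨hP.order_lt s hs, ht, .inl h⟩

omit [Finite V] in
lemma order_lt_of_path {k : ℕ} {s t : GraphSep G} (hs : s.order < k)
    (h : ReflTransGen (IsStep k) s t) : t.order < k := by
  induction h with
  | refl => exact hs
  | tail _ h _ => exact h.2.1

lemma isPartialTangle_generated {k : ℕ} (hk : 0 < k)
    (h : ¬ ReflTransGen (IsUpStep k) (bot G) (top G)) :
    IsPartialTangle k {s | ReflTransGen (IsStep k) (bot G) s} where
  order_lt s hs := order_lt_of_path (by simpa using hk) hs
  bot_mem := .refl
  closed s hs t hst := hs.tail hst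
  not_both s hs hs' :=
    -- Contraposing the path to `inv s` turns it into a path from `s` to `(V, ∅)`.
    h (isUpStep_path_bot_top hk (hs.trans (reflTransGen_isStep_inv hs')))

/-- A least separation not oriented by `P` does not force its own inverse. -/
lemma IsPartialTangle.not_path_inv {k : ℕ} {P : Set (GraphSep G)} (hP : IsPartialTangle k P)
    {x : GraphSep G} (hx : x.order < k) (hxP' : inv x ∉ P)
    (hmin : ∀ y : GraphSep G, y.order < x.order → y ∈ P ∨ inv y ∈ P) :
    ¬ ReflTransGen (IsStep k) x (inv x) := by
  intro h
  obtain ⟨w, z, hw, hwx, hwz, hxz⟩ := exists_isUpStep_path_of_isStep_path hx h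
  have hx' : (inv x).order < k := (order_inv x).trans_lt hx
  -- A `y` of smaller order would already be oriented by `P`. Either orientation puts `inv x` into
  -- `P`: `y` lies above it, while `inv y` forces it through `inv z` and the inverted up-path.
  have hm : ∀ y, inv x ≤ y → y ≤ z → (inv x).order ≤ y.order := by
    intro y hxy hyz
    by_contra! hlt
    rw [order_inv] at hlt
    rcases hmin y hlt with hy | hy
    · exact hxP' (hP.mem_of_le hy hxy hx')
    · have hwz' := reflTransGen_isStep_inv (isStep_of_reflTransGen_isUpStep hwz)
      have hz : z.order < k := order_lt_of_path hw (isStep_of_reflTransGen_isUpStep hwz)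
      have hz' : inv z ∈ P := hP.mem_of_le hy (inv_le_inv hyz) ((order_inv z).trans_lt hz)
      exact hxP' (hP.mem_of_le (hP.mem_of_path hz' hwz') (inv_le_inv hwx) hx')
  have hpath := reflTransGen_isUpStep_inf hwz hxz hm
  have hle : inf w (inv x) ≤ inf x (inv x) := inf_le_inf hwx _
  have hlt : (inf w (inv x)).order < k :=
    order_lt_of_path hx' (s := inv x) (by
      have h₁ := hm (sup w (inv x)) (le_sup_right _ _)
        (sup_le (le_of_reflTransGen_isUpStep hwz) hxz)
      have h₂ := order_sup_add_order_inf w (inv x)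
      exact .single ⟨hx', by omega, .inl (inf_le_right _ _)⟩)
  -- For `x = (A, B)` this infimum is `(A ∩ B, V)`, a single bag of size `< k`. The truncated
  -- up-path starts below it, so `P` would already force `inv x`.
  have hup : IsUpStep k (bot G) (inf x (inv x)) := ⟨bot_le _, by simpa [order] using hx⟩
  exact hxP' (hP.mem_of_path
    (hP.mem_of_le (hP.closed _ hP.bot_mem _ hup.isStep) hle hlt)
    (isStep_of_reflTransGen_isUpStep hpath))

/-- By contraposition, any contradiction would make `P` or `x` force `inv x`. Closure of `P`
excludes the first, minimality of the order of `x` the second. -/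
lemma IsPartialTangle.extend {k : ℕ} {P : Set (GraphSep G)} (hP : IsPartialTangle k P)
    {x : GraphSep G} (hx : x.order < k) (hxP' : inv x ∉ P)
    (hmin : ∀ y : GraphSep G, y.order < x.order → y ∈ P ∨ inv y ∈ P) :
    IsPartialTangle k (P ∪ {s | ReflTransGen (IsStep k) x s}) where
  order_lt s hs := hs.elim (hP.order_lt s) (order_lt_of_path hx)
  bot_mem := .inl hP.bot_mem
  closed s hs t hst := hs.imp (fun h => hP.closed s h t hst) (fun h => h.tail hst)
  not_both s hs hs' := by
    rcases hs with hs | hs <;> rcases hs' with hs' | hs'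
    · exact hP.not_both s hs hs'
    · exact hxP' (hP.mem_of_path hs (reflTransGen_isStep_inv hs'))
    · exact hxP' (hP.mem_of_path hs' (reflTransGen_isStep_inv hs))
    · exact hP.not_path_inv hx hxP' hmin (hs.trans (reflTransGen_isStep_inv hs'))

lemma exists_total_isPartialTangle {k : ℕ} (hk : 0 < k)
    (h : ¬ ReflTransGen (IsUpStep k) (bot G) (top G)) :
    ∃ P : Set (GraphSep G), IsPartialTangle k P ∧
      ∀ s : GraphSep G, s.order < k → s ∈ P ∨ inv s ∈ P := by
  obtain ⟨P, hP, hmax⟩ := (Set.toFinite {P : Set (GraphSep G) | IsPartialTangle k P}).exists_maximal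
    ⟨_, isPartialTangle_generated hk h⟩
  refine ⟨P, hP, ?_⟩
  by_contra! hne
  obtain ⟨x, ⟨hx, hxP, hxP'⟩, hmin⟩ :=
    Set.exists_min_image {s : GraphSep G | s.order < k ∧ s ∉ P ∧ inv s ∉ P} GraphSep.order
      (Set.toFinite _) hne
  refine hxP (hmax (hP.extend hx hxP' fun y hy => ?_) Set.subset_union_left (.inr .refl))
  by_contra! hy'
  exact (hmin y ⟨hy.trans hx, hy'.1, hy'.2⟩).not_gt hy

/-- Shrinking the right side is an up-step whose bag is the separator of `s`. Thus membership in `P`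
depends only on the left side, as a blockage requires. -/
lemma IsPartialTangle.ofSet_mem {k : ℕ} {P : Set (GraphSep G)} (hP : IsPartialTangle k P)
    {s : GraphSep G} (hs : s ∈ P) : ofSet G s.left ∈ P := by
  refine hP.closed s hs _ (IsUpStep.isStep ⟨le_ofSet s, ?_⟩)
  rw [ofSet_left, Set.inter_comm]
  exact hP.order_lt s hs

/-- The left sides of a total partial tangle form a blockage. -/
lemma IsPartialTangle.isBlockage {n : ℕ} {P : Set (GraphSep G)}
    (hP : IsPartialTangle (n + 1) P)
    (htot : ∀ s : GraphSep G, s.order < n + 1 → s ∈ P ∨ inv s ∈ P) :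
    IsBlockage G n (GraphSep.left '' P) := by
  have hmem : ∀ s : GraphSep G, s.order < n + 1 → s.left ∈ GraphSep.left '' P → s ∈ P := by
    rintro s hs ⟨t, ht, hts⟩
    exact hP.mem_of_le (hP.ofSet_mem ht) (hts ▸ le_ofSet s) hs
  refine ⟨?_, ?_, ?_⟩
  · rintro _ ⟨s, hs, rfl⟩
    rw [← order_ofSet]
    exact hP.order_lt _ (hP.ofSet_mem hs)
  · rintro _ ⟨s, hs, rfl⟩ X hX hXb
    rw [← order_ofSet] at hXb
    exact ⟨ofSet G X, hP.mem_of_le (hP.ofSet_mem hs) (ofSet_mono hX) hXb, rfl⟩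
  · intro s hs
    have hs' : (inv s).order < n + 1 := (order_inv s).trans_lt hs
    rcases htot s hs with h | h
    · refine ⟨s.left, ⟨.inl rfl, s, h, rfl⟩, ?_⟩
      rintro _ ⟨rfl | rfl, hX⟩
      · rfl
      · exact (hP.not_both s h (hmem (inv s) hs' hX)).elim
    · refine ⟨s.right, ⟨.inr rfl, inv s, h, rfl⟩, ?_⟩
      rintro _ ⟨rfl | rfl, hX⟩
      · exact (hP.not_both s (hmem s hs hX) h).elim
      · rfl

end Steps
-- From blockages to tangles.
section Tangles

variable {V : Type*} {G : SimpleGraph V}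

open GraphSep

lemma IsBlockage.univ_notMem [Nonempty V] {n : ℕ} {B : Set (Set V)} (hB : IsBlockage G n B) :
    Set.univ ∉ B := by
  intro h
  have h₁ := (hB.exactly_one (top G) (by simp [sepsBelow, order])).unique
    ⟨.inl rfl, h⟩
    ⟨.inr rfl, hB.subset_mem _ h ∅ (Set.empty_subset _) (by simp [boundary])⟩
  exact Set.empty_ne_univ h₁.symm

/-- Uniqueness concerns sets, so the case of equal sides needs excluding; both would then be `V`. -/
lemma IsBlockage.right_notMem [Nonempty V] {n : ℕ} {B : Set (Set V)} (hB : IsBlockage G n B)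
    {s : GraphSep G} (hs : s.order < n + 1) (h : s.left ∈ B) : s.right ∉ B := by
  intro h'
  have h₁ := (hB.exactly_one s hs).unique ⟨.inl rfl, h⟩ ⟨.inr rfl, h'⟩
  have h₂ := s.cover
  rw [← h₁, Set.union_self] at h₂
  exact hB.univ_notMem (h₂ ▸ h)

lemma IsBlockage.left_mem_or_right_mem {n : ℕ} {B : Set (Set V)} (hB : IsBlockage G n B)
    {s : GraphSep G} (hs : s.order < n + 1) : s.left ∈ B ∨ s.right ∈ B := by
  obtain ⟨X, ⟨rfl | rfl, h⟩, -⟩ := hB.exactly_one s hs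
  exacts [.inl h, .inr h]

lemma ncard_boundary_left_le [Finite V] (s : GraphSep G) :
    (boundary G s.left).ncard ≤ s.order := by
  refine Set.ncard_le_ncard ?_
  rintro v ⟨hv, w, hw, hvw⟩
  refine ⟨hv, ?_⟩
  by_contra hv'
  exact s.not_adj hv' hw hvw

/-- A blockage orients every separation towards the side outside the blockage. -/
lemma IsBlockage.isTangle [Finite V] [Nonempty V] {n : ℕ} {B : Set (Set V)}
    (hB : IsBlockage G n B) :
    IsTangle (sepsBelow G (n + 1)) (starsTwo G (n + 1))
      {s | s.order < n + 1 ∧ s.left ∈ B} := by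
  refine ⟨⟨fun s hs => hs.1, fun s hs => ?_⟩, ?_, ?_⟩
  · rcases hB.left_mem_or_right_mem hs with h | h
    · refine ⟨s, ⟨.inl rfl, hs, h⟩, ?_⟩
      rintro _ ⟨rfl | rfl, -, hX⟩
      · rfl
      · exact (hB.right_notMem hs h hX).elim
    · refine ⟨inv s, ⟨.inr rfl, (order_inv s).trans_lt hs, h⟩, ?_⟩
      rintro _ ⟨rfl | rfl, -, hX⟩
      · exact (hB.right_notMem hs hX h).elim
      · rfl
  · rintro r hr s - - hrs ⟨⟨-, h₁⟩, -, h₂⟩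
    exact hB.right_notMem hr (hB.subset_mem _ h₂ _ hrs.le.1
      ((ncard_boundary_left_le r).trans_lt hr)) h₁
  · rintro σ hσ ⟨-, ⟨-, hstar⟩, s, t, rfl, hst⟩
    obtain ⟨hs, hsB⟩ := hσ (.inl rfl)
    obtain ⟨ht, htB⟩ := hσ (.inr rfl)
    by_cases hne : s = t
    · subst hne
      -- In both cases the bag of the star is the separator of a separation of order `< n + 1`,
      -- neither side of which can lie in the blockage.
      have hu : IsUpStep (n + 1) s (top G) := ⟨le_top s, by simpa using hst⟩
      have hu' : (bag hu.1).order < n + 1 := by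
        simpa [order] using hst
      rcases hB.left_mem_or_right_mem hu' with h | h
      · exact hB.univ_notMem h
      · exact hB.right_notMem hs hsB h
    · have hle : s ≤ inv t := hstar s (.inl rfl) t (.inr rfl) hne
      have hu : (bag hle).order < n + 1 := by
        rwa [order, bag_left, bag_right, inv_left, Set.inter_comm]
      rcases hB.left_mem_or_right_mem hu with h | h
      · exact hB.right_notMem ht htB h
      · exact hB.right_notMem hs hsB h

end Tangles

/-! ### Tangles exclude trees. -/

section Duality

/-- A tangle and a tree over the same set of stars exclude each other. -/
lemma IsTangle.not_hasSTreeOver {U : Type*} [SeparationSystem U] {S O : Set U}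
    {F : Set (Set U)} (hO : IsTangle S F O) : ¬ HasSTreeOver S F := by
  rintro ⟨N, T, α, hT⟩
  have hfin := hT.finite_nodes
  -- If no edge pointed out of `t`, the star at `t` would be a subset of `O`. Distinct nodes get
  -- distinct edges, too many for a tree.
  have hout : ∀ t : N, ∃ e : T.Dart, e.fst = t ∧ α e ∈ O ∧ α e.symm ∉ O := by
    intro t
    by_contra! h
    refine hO.2.2 _ ?_ (hT.star_mem t)
    rintro _ ⟨e, rfl, rfl⟩
    obtain ⟨x, ⟨hx | hx, hxO⟩, -⟩ := hO.1.2 (α e) (hT.mem e)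
    · exact hx ▸ hxO
    · rw [Set.mem_singleton_iff.1 hx, ← hT.map_symm] at hxO
      simpa using h e.symm rfl hxO
  choose f hf hfO hfO' using hout
  have hinj : Function.Injective fun t => (⟨(f t).edge, (f t).edge_mem⟩ : T.edgeSet) := by
    intro s t hst
    rcases SimpleGraph.dart_edge_eq_iff _ _ |>.1 (congrArg Subtype.val hst) with h | h
    · rw [← hf s, ← hf t, h]
    · exact (hfO' t (h ▸ hfO s)).elim
  have h₁ := (SimpleGraph.isTree_iff_connected_and_card.1 hT.isTree).2
  have h₂ : Nat.card N ≤ Nat.card T.edgeSet := Nat.card_le_card_of_injective _ hinj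
  omega

end Duality

/-! ### Path graphs as trees. -/

section Paths

open SimpleGraph

lemma isTree_pathGraph (n : ℕ) : (pathGraph (n + 1)).IsTree := by
  have hc := pathGraph_connected n
  refine isTree_iff_connected_and_card.2 ⟨hc, le_antisymm ?_ hc.card_vert_le_card_edgeSet_add_one⟩
  have hsurj : Function.Surjective fun i : Fin n =>
      (⟨s(i.castSucc, i.succ), by simp [pathGraph_adj]⟩ : (pathGraph (n + 1)).edgeSet) := by
    rintro ⟨e, he⟩
    induction e with
    | _ u v =>
      have h : u.val + 1 = v.val ∨ v.val + 1 = u.val := pathGraph_adj.1 he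
      rcases h with h | h
      · refine ⟨⟨u, by omega⟩, Subtype.ext ?_⟩
        have hv : v = Fin.succ ⟨u, by omega⟩ := Fin.ext h.symm
        exact congrArg (fun w => s(u, w)) hv.symm
      · refine ⟨⟨v, by omega⟩, Subtype.ext ?_⟩
        have hu : u = Fin.succ ⟨v, by omega⟩ := Fin.ext h.symm
        exact Sym2.eq_swap.trans (congrArg (fun w => s(w, v)) hu.symm)
  simpa using Nat.card_le_card_of_surjective _ hsurj

/-- A walk in a path graph visits everything between its ends. -/
lemma mem_support_of_mem_uIcc {n : ℕ} {a b : Fin n} (p : (pathGraph n).Walk a b) {x : Fin n}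
    (hx : x ∈ Set.uIcc a b) : x ∈ p.support := by
  induction p with
  | nil => simpa using hx
  | @cons a c b h p ih =>
    rw [Walk.support_cons, List.mem_cons]
    by_cases hxa : x = a
    · exact .inl hxa
    · refine .inr (ih ?_)
      rw [pathGraph_adj] at h
      rw [Set.mem_uIcc] at hx ⊢
      simp only [Fin.le_def, Fin.ext_iff] at *
      omega

/-- A path in a path graph only visits nodes between its ends. -/
lemma mem_uIcc_of_mem_support {n : ℕ} {a b : Fin n} (p : (pathGraph n).Walk a b)
    (hp : p.IsPath) {x : Fin n} (hx : x ∈ p.support) : x ∈ Set.uIcc a b := by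
  induction p with
  | nil => simpa using hx
  | @cons a c b h p ih =>
    rw [Walk.cons_isPath_iff] at hp
    rw [Walk.support_cons, List.mem_cons] at hx
    rcases hx with rfl | hx
    · exact Set.left_mem_uIcc
    · have h₁ := ih hp.1 hx
      have h₂ : a ∉ Set.uIcc c b := fun h => hp.2 (mem_support_of_mem_uIcc p h)
      rw [pathGraph_adj] at h
      rw [Set.mem_uIcc] at h₁ h₂ ⊢
      simp only [Fin.le_def] at *
      omega

end Paths

/-! ### Up-paths, path-decompositions and `S_k`-trees. -/

section Chains

open GraphSep

variable {V : Type*} {G : SimpleGraph V} {k : ℕ}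

/-- A sequence of `n` steps from `(∅, V)` to `(V, ∅)`, each adding a bag of size `< k`. -/
structure IsBagSequence (k n : ℕ) (f : ℕ → GraphSep G) : Prop where
  zero : f 0 = bot G
  last : f n = top G
  step : ∀ i < n, IsUpStep k (f i) (f (i + 1))

lemma reflTransGen_iff_exists_sequence {α : Type*} {r : α → α → Prop} {a b : α} :
    ReflTransGen r a b ↔
      ∃ (n : ℕ) (f : ℕ → α), f 0 = a ∧ f n = b ∧ ∀ i < n, r (f i) (f (i + 1)) := by
  constructor
  · intro h
    induction h with
    | refl => exact ⟨0, fun _ => a, rfl, rfl, by simp⟩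
    | @tail b c _ hbc ih =>
      obtain ⟨n, f, h₀, hn, hf⟩ := ih
      refine ⟨n + 1, fun i => if i ≤ n then f i else c, by simpa, by simp, fun i hi => ?_⟩
      rcases Nat.lt_succ_iff_lt_or_eq.1 hi with hi | rfl
      · simpa [hi.le, Nat.succ_le_iff.2 hi] using hf i hi
      · simpa [hn] using hbc
  · rintro ⟨n, f, rfl, rfl, hf⟩
    induction n with
    | zero => exact .refl
    | succ n ih => exact (ih fun i hi => hf i (by omega)).tail (hf n (by omega))

lemma exists_isBagSequence_iff :
    (∃ (n : ℕ) (f : ℕ → GraphSep G), IsBagSequence k n f) ↔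
      ReflTransGen (IsUpStep k) (bot G) (top G) := by
  rw [reflTransGen_iff_exists_sequence]
  exact exists_congr fun n => exists_congr fun f =>
    ⟨fun h => ⟨h.zero, h.last, h.step⟩, fun h => ⟨h.1, h.2.1, h.2.2⟩⟩

namespace IsBagSequence

variable {n : ℕ} {f : ℕ → GraphSep G}

lemma mono (hf : IsBagSequence k n f) {i j : ℕ} (hij : i ≤ j) (hj : j ≤ n) : f i ≤ f j := by
  induction j, hij using Nat.le_induction with
  | base => exact le_rfl
  | succ j _ ih => exact (ih (by omega)).trans (hf.step j (by omega)).1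

/-- A property of left sides that fails for `∅` and holds for `V` is acquired at some bag. -/
lemma exists_switch (hf : IsBagSequence k n f) (p : Set V → Prop) (h₀ : ¬ p ∅)
    (h₁ : p Set.univ) : ∃ i < n, ¬ p (f i).left ∧ p (f (i + 1)).left := by
  by_contra! h
  have : ∀ i ≤ n, ¬ p (f i).left := by
    intro i hi
    induction i with
    | zero => rwa [hf.zero]
    | succ i ih => exact h i (by omega) (ih (by omega))
  exact this n le_rfl (by rwa [hf.last])

lemma pos [Nonempty V] (hf : IsBagSequence k n f) : 0 < n := by
  obtain ⟨v⟩ := ‹Nonempty V›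
  obtain ⟨i, hi, -⟩ := hf.exists_switch (v ∈ ·) (by simp) (by simp)
  omega

/-- The bags of a bag sequence form a path-decomposition. -/
lemma isTreeDecomposition [Nonempty V] (hf : IsBagSequence k n f) :
    IsTreeDecomposition G (SimpleGraph.pathGraph n)
      fun i : Fin n => (f i).right ∩ (f (i + 1)).left where
  isTree := by
    obtain ⟨m, rfl⟩ := Nat.exists_eq_succ_of_ne_zero hf.pos.ne'
    exact isTree_pathGraph m
  vertex_mem v := by
    obtain ⟨i, hi, h₀, h₁⟩ := hf.exists_switch (v ∈ ·) (by simp) (by simp)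
    exact ⟨⟨i, hi⟩, ((f i).mem_left_or_mem_right v).resolve_left h₀, h₁⟩
  edge_mem u v huv := by
    -- At the bag where the left side first holds both ends, an end missing from the right side of
    -- `f i` would leave `uv` crossing `f i`.
    obtain ⟨i, hi, h₀, h₁⟩ := hf.exists_switch (fun X => u ∈ X ∧ v ∈ X) (by simp) (by simp)
    refine ⟨⟨i, hi⟩, ⟨?_, h₁.1⟩, ?_, h₁.2⟩
    · by_contra hu
      exact (f i).not_adj hu
        (fun hv => h₀ ⟨((f i).mem_left_or_mem_right u).resolve_right hu, hv⟩) huv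
    · by_contra hv
      exact (f i).not_adj hv
        (fun hu => h₀ ⟨hu, ((f i).mem_left_or_mem_right v).resolve_right hv⟩) huv.symm
  inter_subset a c p hp b hb := by
    have hb' := mem_uIcc_of_mem_support p hp hb
    rw [Set.mem_uIcc] at hb'
    simp only [Fin.le_def] at hb'
    rintro v ⟨ha, hc⟩
    rcases hb' with h | h
    · exact ⟨(hf.mono h.2 c.2.le).2 hc.1, (hf.mono (by omega) (by omega)).1 ha.2⟩
    · exact ⟨(hf.mono h.2 a.2.le).2 ha.1, (hf.mono (by omega) (by omega)).1 hc.2⟩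

end IsBagSequence

/-- A path-decomposition into bags of size `< k` yields a bag sequence. -/
lemma IsTreeDecomposition.exists_isBagSequence [Finite V] {n : ℕ} {bag : Fin n → Set V}
    (h : IsTreeDecomposition G (SimpleGraph.pathGraph n) bag) (hbag : ∀ i, (bag i).ncard < k) :
    ∃ f : ℕ → GraphSep G, IsBagSequence k n f := by
  -- The union of the bags before `i` is separated from the union of the rest. The bag of step `i`
  -- then lies inside `bag i`, by the path axiom.
  refine ⟨fun i => mk' {v | ∃ j : Fin n, j < i ∧ v ∈ bag j} {v | ∃ j : Fin n, i ≤ j ∧ v ∈ bag j}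
    (fun v => ?_) (fun u v hu hv huv => ?_), ?_, ?_, fun i hi => ⟨⟨?_, ?_⟩, ?_⟩⟩
  · obtain ⟨j, hj⟩ := h.vertex_mem v
    exact (lt_or_ge (j : ℕ) i).imp (fun hji => ⟨j, hji, hj⟩) (fun hji => ⟨j, hji, hj⟩)
  · obtain ⟨j, hju, hjv⟩ := h.edge_mem u v huv
    rcases lt_or_ge (j : ℕ) i with hji | hji
    · exact hv ⟨j, hji, hjv⟩
    · exact hu ⟨j, hji, hju⟩
  · ext v
    · simp [mk']
    · simpa [mk'] using h.vertex_mem v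
  · ext v
    · simpa [mk'] using h.vertex_mem v
    · simp [mk']
  · rintro v ⟨j, hj, hv⟩
    exact ⟨j, by omega, hv⟩
  · rintro v ⟨j, hj, hv⟩
    exact ⟨j, by omega, hv⟩
  · refine (Set.ncard_le_ncard ?_).trans_lt (hbag ⟨i, hi⟩)
    rintro v ⟨⟨j, hj, hvj⟩, l, hl, hvl⟩
    obtain ⟨p, hp⟩ := (h.isTree.connected.preconnected l j).exists_isPath
    refine h.inter_subset l j p hp ⟨i, hi⟩ (mem_support_of_mem_uIcc p ?_) ⟨hvl, hvj⟩
    exact Set.mem_uIcc.2 (.inl ⟨Fin.le_def.2 (by simp; omega), Fin.le_def.2 hj⟩)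

lemma ncard_le_decompositionWidth {n : ℕ} (bag : Fin n → Set V) (i : Fin n) :
    (bag i).ncard ≤ decompositionWidth bag + 1 := by
  have h := le_ciSup (f := fun t => (bag t).ncard) (Set.finite_range _).bddAbove i
  unfold decompositionWidth
  omega

lemma exists_isBagSequence_of_pathWidth_lt [Finite V] [Nonempty V]
    (h : pathWidth G + 1 < k) : ∃ (n : ℕ) (f : ℕ → GraphSep G), IsBagSequence k n f := by
  -- The infimum is attained only if some path-decomposition exists; one comes from the single step
  -- with bag `V`.
  have hne : {w | ∃ (n : ℕ) (bag : Fin n → Set V),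
      IsTreeDecomposition G (SimpleGraph.pathGraph n) bag ∧ decompositionWidth bag = w}.Nonempty := by
    obtain ⟨n, f, hf⟩ := exists_isBagSequence_iff.2 (.single
      ⟨le_top (bot G), Nat.lt_succ_self (((bot G).right ∩ (top G).left).ncard)⟩)
    exact ⟨_, n, _, hf.isTreeDecomposition, rfl⟩
  obtain ⟨n, bag, hbag, hw⟩ := Nat.sInf_mem hne
  obtain ⟨f, hf⟩ := hbag.exists_isBagSequence (k := k) fun i =>
    (ncard_le_decompositionWidth bag i).trans_lt (by rw [hw]; exact h)
  exact ⟨n, f, hf⟩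

lemma IsBagSequence.pathWidth_lt [Finite V] [Nonempty V] {n : ℕ} {f : ℕ → GraphSep G}
    (hf : IsBagSequence k n f) : pathWidth G + 1 < k := by
  have hdec := hf.isTreeDecomposition
  have hle : pathWidth G ≤ _ := Nat.sInf_le ⟨n, _, hdec, rfl⟩
  refine (Nat.add_le_add_right hle 1).trans_lt ?_
  have : Nonempty (Fin n) := ⟨⟨0, hf.pos⟩⟩
  obtain ⟨v⟩ := ‹Nonempty V›
  obtain ⟨i, hi⟩ := hdec.vertex_mem v
  -- A nonempty bag forces `2 ≤ k`, without which the truncated subtraction in the width would break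
  -- the bound.
  have h₁ := (Set.ncard_pos (Set.toFinite _)).2 ⟨v, hi⟩
  have h₂ := hf.step i i.2 |>.2
  have h₃ : (⨆ i : Fin n, ((f i).right ∩ (f (i + 1)).left).ncard) ≤ k - 1 :=
    ciSup_le fun j => Nat.le_sub_one_of_lt (hf.step j j.2).2
  simp only [decompositionWidth]
  omega

lemma pair_mem_starsTwo [Finite V] {s t : GraphSep G} (h : IsUpStep k s t) :
    {s, inv t} ∈ starsTwo G k := by
  refine ⟨?_, ⟨⟨s, .inl rfl⟩, ?_⟩, s, inv t, rfl, h.2⟩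
  · rintro _ (rfl | rfl)
    · exact h.order_left_lt
    · exact (order_inv t).trans_lt h.order_right_lt
  · rintro _ (rfl | rfl) _ (rfl | rfl) hne
    · exact (hne rfl).elim
    · exact h.1
    · exact inv_le_inv h.1
    · exact (hne rfl).elim

/-- This is the star at both leaves of the path. -/
lemma top_mem_starsTwo (hk : 0 < k) : {top G} ∈ starsTwo G k := by
  refine ⟨?_, ⟨⟨_, rfl⟩, ?_⟩, top G, top G, by simp, by simpa using hk⟩
  · rintro _ rfl
    simpa [sepsBelow, order] using hk
  · rintro _ rfl _ rfl hne
    exact (hne rfl).elim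

/-- A bag sequence, read along a path, is a tree over the stars of at most two separations. -/
lemma IsBagSequence.hasSTreeOver [Finite V] (hk : 0 < k) {n : ℕ} {f : ℕ → GraphSep G}
    (hf : IsBagSequence k n f) : HasSTreeOver (sepsBelow G k) (starsTwo G k) := by
  have hord : ∀ i ≤ n, (f i).order < k := by
    intro i hi
    rcases hi.lt_or_eq with hi | rfl
    · exact (hf.step i hi).order_left_lt
    · rw [hf.last]
      simpa [order] using hk
  -- The `n + 1` edges carry `f 0, …, f n`. Inner node `t` gets the star of step `t - 1`; the two
  -- extra end nodes see only `inv (f 0)` and `f n`, both equal to `(V, ∅)`.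
  let α : (SimpleGraph.pathGraph (n + 2)).Dart → GraphSep G := fun e =>
    if e.fst < e.snd then f e.fst else inv (f e.snd)
  have hadj : ∀ e : (SimpleGraph.pathGraph (n + 2)).Dart,
      e.fst.val + 1 = e.snd.val ∨ e.snd.val + 1 = e.fst.val :=
    fun e => SimpleGraph.pathGraph_adj.1 e.adj
  have hup : ∀ e, e.fst.val + 1 = e.snd.val → α e = f e.fst := fun e he =>
    if_pos (Fin.lt_def.2 (by omega))
  have hdown : ∀ e, e.snd.val + 1 = e.fst.val → α e = inv (f e.snd) := fun e he =>
    if_neg (by rw [Fin.lt_def]; omega)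
  have himage : ∀ (t : Fin (n + 2)) (s : GraphSep G), s ∈ α '' {e | e.snd = t} ↔
      (0 < t.val ∧ s = f (t - 1)) ∨ (t.val ≤ n ∧ s = inv (f t)) := by
    intro t s
    constructor
    · rintro ⟨e, rfl, rfl⟩
      rcases hadj e with he | he
      · exact .inl ⟨by omega, by rw [hup e he, ← he, Nat.add_sub_cancel]⟩
      · exact .inr ⟨by omega, hdown e he⟩
    · rintro (⟨ht, rfl⟩ | ⟨ht, rfl⟩)
      · let e : (SimpleGraph.pathGraph (n + 2)).Dart :=
          ⟨(⟨t - 1, by omega⟩, t), SimpleGraph.pathGraph_adj.2 (.inl (by simp; omega))⟩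
        exact ⟨e, rfl, hup e (by simp [e]; omega)⟩
      · let e : (SimpleGraph.pathGraph (n + 2)).Dart :=
          ⟨(⟨t + 1, by omega⟩, t), SimpleGraph.pathGraph_adj.2 (.inr (by simp))⟩
        exact ⟨e, rfl, hdown e (by simp [e])⟩
  refine ⟨Fin (n + 2), _, α, inferInstance, isTree_pathGraph (n + 1), ?_, ?_, ?_, ?_⟩
  · exact ⟨s(0, 1), SimpleGraph.pathGraph_adj.2 (.inl (by simp))⟩
  · intro e
    rcases hadj e with he | he
    · rw [hup e he]
      exact hord _ (by omega)
    · rw [hdown e he]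
      exact (order_inv _).trans_lt (hord _ (by omega))
  · intro e
    rcases hadj e with he | he
    · rw [hup e he]
      exact hdown e.symm he
    · rw [hdown e he]
      exact hup e.symm he
  · intro t
    by_cases h₀ : t.val = 0
    · convert top_mem_starsTwo hk using 1
      ext s
      rw [himage, h₀, hf.zero]
      simp [top]
    by_cases h₁ : t.val = n + 1
    · convert top_mem_starsTwo hk using 1
      ext s
      rw [himage, h₁, Nat.add_sub_cancel, hf.last]
      simp
    · have hstep := hf.step (t - 1) (by omega)
      rw [Nat.sub_add_cancel (by omega)] at hstep
      convert pair_mem_starsTwo hstep using 1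
      ext s
      rw [himage]
      have h₂ : 0 < t.val := by omega
      have h₃ : t.val ≤ n := by omega
      simp [h₂, h₃]

end Chains
end SepDuality

theorem mainTheorem7 {V : Type*} [Finite V] [Nonempty V] (G : SimpleGraph V)
    (k : ℕ) (hk : 0 < k) :
    List.TFAE
      [∃ B : Set (Set V), SepDuality.IsBlockage G (k - 1) B,
       ∃ O : Set (SepDuality.GraphSep G),
        SepDuality.IsTangle (SepDuality.sepsBelow G k) (SepDuality.starsTwo G k) O,
       ¬ SepDuality.HasSTreeOver (SepDuality.sepsBelow G k) (SepDuality.starsTwo G k),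
       k - 1 ≤ SepDuality.pathWidth G] := by
  obtain ⟨n, rfl⟩ : ∃ n, k = n + 1 := ⟨k - 1, by omega⟩
  rw [Nat.add_sub_cancel]
  tfae_have 1 → 2 := fun ⟨_, hB⟩ => ⟨_, hB.isTangle⟩
  tfae_have 2 → 3 := fun ⟨_, hO⟩ => hO.not_hasSTreeOver
  tfae_have 3 → 4 := by
    intro h
    by_contra! hlt
    obtain ⟨m, f, hf⟩ :=
      SepDuality.exists_isBagSequence_of_pathWidth_lt (G := G) (Nat.succ_lt_succ hlt)
    exact h (hf.hasSTreeOver hk)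
  tfae_have 4 → 1 := by
    intro h
    have hseq : ¬ Relation.ReflTransGen (SepDuality.IsUpStep (n + 1))
        (SepDuality.GraphSep.bot G) (SepDuality.GraphSep.top G) := by
      rw [← SepDuality.exists_isBagSequence_iff]
      rintro ⟨m, f, hf⟩
      have := hf.pathWidth_lt
      omega
    obtain ⟨P, hP, htot⟩ := SepDuality.exists_total_isPartialTangle hk hseq
    exact ⟨_, hP.isBlockage htot⟩
  tfae_finish
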